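/- A \emph{network} is a finite directed acyclic multigraph in which each message is generated at one node (its source) and demanded at one or more nodes. Given positive integers $k,n$ and a finite alphabet $\mathcal A$ with at least two elements, a message is an arbitrary vector in $\mathcal A^k$ and each edge carries a vector in $\mathcal A^n$. The inputs of a node are the vectors on its in-edges and the messages generated at it. A $(k,n)$-coding solution over $\mathcal A$ assigns to each edge a function of the inputs of its tail, and to each message demanded at a node a function of the inputs of that node, such that for all values of the messages every demanded message is recovered. The solution is linear if $\mathcal A$ is a finite field and all these functions are linear. The coding capacity over $\mathcal A$ (respectively the linear coding capacity over a finite field $\mathcal A=F$) is the supremum of $k/n$ over all $k,n\ge 1$ for which a $(k,n)$-coding solution (respectively a linear one) over $\mathcal A$ exists. The \emph{non-T8 network} has messages $A,B,C,D$, generated at four source nodes $s_A,s_B,s_C,s_D$, further nodes $n_1,\dots,n_{15}$, and the following edges, each of multiplicity one: (i) from $s_B,s_C,s_D$ to $n_1$; from $s_A,s_C,s_D$ to $n_3$; from $s_A,s_B,s_D$ to $n_5$; from $s_A,s_B,s_C$ to $n_7$; (ii) $(n_1,n_2)$, $(n_3,n_4)$, $(n_5,n_6)$, $(n_7,n_8)$;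 (iii) from $s_B,n_2,n_4$ to $n_9$; from $s_A,n_2,n_6$ to $n_{10}$; from $s_C,n_4,n_6$ to $n_{11}$; from $s_A,n_2,n_8$ to $n_{12}$; from $s_D,n_4,n_8$ to $n_{13}$; from $s_D,n_6,n_8$ to $n_{14}$; from $n_2,n_4,n_6,n_8$ to $n_{15}$. The nodes $n_9,n_{10},n_{11},n_{12},n_{13},n_{14},n_{15}$ demand the messages $A,C,B,D,B,C,A$, respectively. \textbf{Corollary.} For the non-T8 network, the linear coding capacity over every finite field of characteristic $3$ is at most $28/29$; the linear coding capacity over every finite field of characteristic different from $3$ is equal to $1$; and the coding capacity over every finite alphabet with at least two elements is equal to $1$. -/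

import Mathlib

open scoped ENNReal

/-- A network: a finite directed acyclic multigraph with messages and demands. Each message is
generated at one node (its source) and is demanded by at least one node. -/
structure Network where
  Node : Type
  Edge : Type
  Msg : Type
  finite_node : Finite Node
  finite_edge : Finite Edge
  finite_msg : Finite Msg
  tail : Edge → Node
  head : Edge → Node
  acyclic : ∀ v, ¬ Relation.TransGen (fun u w => ∃ e, tail e = u ∧ head e = w) v v
  source : Msg → Node
  demands : Node → Set Msg
  demanded : ∀ m, ∃ v, m ∈ demands v

namespace Network

/-- The inputs of the node `v`: the vectors of `n` symbols carried on the in-edges of `v`,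
and the vectors of `k` symbols that are the messages generated at `v`. -/
abbrev Inputs (N : Network) (𝒜 : Type*) (k n : ℕ) (v : N.Node) :=
  ({e : N.Edge // N.head e = v} → Fin n → 𝒜) × ({m : N.Msg // N.source m = v} → Fin k → 𝒜)

/-- A `(k, n)`-code over the alphabet `𝒜`: every out-edge of a node and every message demanded
at a node is assigned a function of the inputs of that node. -/
structure Code (N : Network) (𝒜 : Type*) (k n : ℕ) where
  edgeFn : ∀ e : N.Edge, N.Inputs 𝒜 k n (N.tail e) → Fin n → 𝒜
  decodeFn : ∀ (v : N.Node) (m : N.Msg), m ∈ N.demands v → N.Inputs 𝒜 k n v → Fin k → 𝒜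

/-- The inputs seen by the node `v` when the messages are `x` and the edges carry `y`. -/
def inputs (N : Network) {𝒜 : Type*} {k n : ℕ} (x : N.Msg → Fin k → 𝒜)
    (y : N.Edge → Fin n → 𝒜) (v : N.Node) : N.Inputs 𝒜 k n v :=
  (fun e => y e.1, fun m => x m.1)

/-- A code is a solution if, for all values `x` of the messages, every demanded message is
decoded correctly. Here `y` is the family of vectors carried by the edges; it is determined
by `x` and the edge functions, because the network is acyclic. -/
def Code.IsSolution {N : Network} {𝒜 : Type*} {k n : ℕ} (c : N.Code 𝒜 k n) : Prop :=
  ∀ x : N.Msg → Fin k → 𝒜, ∃ y : N.Edge → Fin n → 𝒜,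
    (∀ e, y e = c.edgeFn e (N.inputs x y (N.tail e))) ∧
    ∀ (v : N.Node) (m : N.Msg) (hm : m ∈ N.demands v), c.decodeFn v m hm (N.inputs x y v) = x m

/-- A code over a field is linear if all edge functions and all decoding functions are linear. -/
def Code.IsLinear {N : Network} {F : Type*} [Field F] {k n : ℕ} (c : N.Code F k n) : Prop :=
  (∀ e, IsLinearMap F (c.edgeFn e)) ∧
    ∀ (v : N.Node) (m : N.Msg) (hm : m ∈ N.demands v), IsLinearMap F (c.decodeFn v m hm)

/-- The coding capacity over the alphabet `𝒜`: the supremum of all `k / n` for which there is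
a `(k, n)`-coding solution over `𝒜`. -/
noncomputable def capacity (N : Network) (𝒜 : Type*) : ℝ≥0∞ :=
  sSup {r | ∃ k n : ℕ, 0 < k ∧ 0 < n ∧ (∃ c : N.Code 𝒜 k n, c.IsSolution) ∧
    r = (k : ℝ≥0∞) / (n : ℝ≥0∞)}

/-- The linear coding capacity over the field `F`: the supremum of all `k / n` for which there
is a linear `(k, n)`-coding solution over `F`. -/
noncomputable def linearCapacity (N : Network) (F : Type*) [Field F] : ℝ≥0∞ :=
  sSup {r | ∃ k n : ℕ, 0 < k ∧ 0 < n ∧ (∃ c : N.Code F k n, c.IsLinear ∧ c.IsSolution) ∧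
    r = (k : ℝ≥0∞) / (n : ℝ≥0∞)}

end Network

namespace NonT8

/-- The four messages. -/
inductive Msg
  | A | B | C | D
  deriving DecidableEq

instance : Fintype Msg := ⟨{.A, .B, .C, .D}, by intro m; cases m <;> decide⟩

/-- The nodes: a source node for each message, and the nodes `n1`, ..., `n15`. -/
inductive Node
  | src (m : Msg)
  | n1 | n2 | n3 | n4 | n5 | n6 | n7 | n8 | n9 | n10 | n11 | n12 | n13 | n14 | n15
  deriving DecidableEq

open Msg Node

instance : Fintype Node :=
  ⟨{src A, src B, src C, src D, n1, n2, n3, n4, n5, n6, n7, n8, n9, n10, n11, n12, n13, n14, n15},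
    by intro v; rcases v with m | _ <;> first | decide | (cases m <;> decide)⟩

/-- The edges, as pairs (tail, head); there are no parallel edges. The edges `(n1, n2)`,
`(n3, n4)`, `(n5, n6)`, `(n7, n8)` carry the vectors called `W`, `X`, `Y`, `Z`. -/
def edges : Finset (Node × Node) :=
  {(src B, n1), (src C, n1), (src D, n1), (n1, n2),
   (src A, n3), (src C, n3), (src D, n3), (n3, n4),
   (src A, n5), (src B, n5), (src D, n5), (n5, n6),
   (src A, n7), (src B, n7), (src C, n7), (n7, n8),
   (src B, n9), (n2, n9), (n4, n9),
   (src A, n10), (n2, n10), (n6, n10),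
   (src C, n11), (n4, n11), (n6, n11),
   (src A, n12), (n2, n12), (n8, n12),
   (src D, n13), (n4, n13), (n8, n13),
   (src D, n14), (n6, n14), (n8, n14),
   (n2, n15), (n4, n15), (n6, n15), (n8, n15)}

/-- The messages demanded at each node. -/
def demands : Node → Set Msg
  | n9 => {A}
  | n10 => {C}
  | n11 => {B}
  | n12 => {D}
  | n13 => {B}
  | n14 => {C}
  | n15 => {A}
  | _ => ∅

/-- The layer of a node; every edge leads to a higher layer. -/
def layer : Node → ℕ
  | src _ => 0
  | n1 | n3 | n5 | n7 => 1
  | n2 | n4 | n6 | n8 => 2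
  | _ => 3

theorem layer_lt : ∀ e ∈ edges, layer e.1 < layer e.2 := by
  simp [edges, layer]

/-- The non-T8 network. -/
def network : Network where
  Node := Node
  Edge := edges
  Msg := Msg
  finite_node := inferInstance
  finite_edge := inferInstance
  finite_msg := inferInstance
  tail e := e.1.1
  head e := e.1.2
  acyclic v h := by
    have key : ∀ a b, Relation.TransGen
        (fun u w => ∃ e : edges, e.1.1 = u ∧ e.1.2 = w) a b → layer a < layer b := by
      intro a b hab
      induction hab with
      | single h1 =>
        obtain ⟨e, rfl, rfl⟩ := h1
        exact layer_lt e.1 e.2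
      | tail _ h1 ih =>
        obtain ⟨e, rfl, rfl⟩ := h1
        exact ih.trans (layer_lt e.1 e.2)
    exact lt_irrefl _ (key v v h)
  source := src
  demands := demands
  demanded m := by
    cases m
    · exact ⟨n9, rfl⟩
    · exact ⟨n11, rfl⟩
    · exact ⟨n10, rfl⟩
    · exact ⟨n12, rfl⟩

end NonT8

/-! Write `W`, `X`, `Y`, `Z` for the vectors on the four bottleneck edges; each misses exactly one
message. Fixing all messages but `B` freezes `X`, so `Y` alone determines `B` at `n11`; hence `k ≤
n` and no capacity exceeds 1 (`le_of_isSolution`).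

Rates near 1 come from sending sums of three messages in an abelian group (`nodeValue`). Nodes `n9`
to `n14` subtract; `n15` computes `X + Y + Z - 2W = 3A`, so only 3-torsion can obstruct. A field of
characteristic other than 3 gives a linear code of rate 1. Any alphabet of size `q` works at rate `k
/ (k + 1)`, by embedding its words in `ZMod M` with `3 ∤ M` and `q ^ k ≤ M ≤ q ^ (k + 1)`.

In characteristic 3, `finrank_le_of_decodable` yields the sharper bound 10/11. Eleven unknown
vectors are subjected to ten vanishing conditions on the bottleneck maps. If there were a nonzero
solution, six decoders would make it consist of `a, b, c, d` with sign changes and zeros; adding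
conditions and using `-2 = 1` shows that all four maps vanish at `(a, b, c, d)`, whence `a = 0`, and
the remaining unknowns vanish too. -/

/-! ### Edge vectors as functions of node inputs. -/

namespace Network

/-- The edge vectors `y` are those produced by the code `c` from the messages `x`. -/
def Code.Carries {N : Network} {𝒜 : Type*} {k n : ℕ} (c : N.Code 𝒜 k n)
    (x : N.Msg → Fin k → 𝒜) (y : N.Edge → Fin n → 𝒜) : Prop :=
  ∀ e, y e = c.edgeFn e (N.inputs x y (N.tail e))

theorem inputs_congr (N : Network) {𝒜 : Type*} {k n : ℕ} {x x' : N.Msg → Fin k → 𝒜}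
    {y y' : N.Edge → Fin n → 𝒜} {v : N.Node} (hy : ∀ e, N.head e = v → y e = y' e)
    (hx : ∀ m, N.source m = v → x m = x' m) : N.inputs x y v = N.inputs x' y' v :=
  Prod.ext (funext fun e => hy e.1 e.2) (funext fun m => hx m.1 m.2)

theorem Code.Carries.congr {N : Network} {𝒜 : Type*} {k n : ℕ} {c : N.Code 𝒜 k n}
    {x x' : N.Msg → Fin k → 𝒜} {y y' : N.Edge → Fin n → 𝒜} (h : c.Carries x y)
    (h' : c.Carries x' y') (e : N.Edge) (hy : ∀ e', N.head e' = N.tail e → y e' = y' e')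
    (hx : ∀ m, N.source m = N.tail e → x m = x' m) : y e = y' e := by
  rw [h e, h' e, N.inputs_congr hy hx]

end Network

namespace NonT8

open Msg Node Network

/-! ### What the bottleneck vectors depend on, what they determine, and `k ≤ n`. -/

section Converse

variable {𝒜 : Type*} {k n : ℕ} {c : network.Code 𝒜 k n} {x x' : Msg → Fin k → 𝒜}
  {y y' : edges → Fin n → 𝒜}

theorem carries_src (h : c.Carries x y) (h' : c.Carries x' y') {m : Msg} (hm : x m = x' m)
    {e : edges} (he : e.1.1 = src m) : y e = y' e := by
  refine h.congr h' e (fun e' h1 => ?_) (fun m' h1 => ?_)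
  · have h2 : e'.1.2 = src m := Eq.trans h1 he
    have : ∀ p ∈ edges, ∀ m, p.2 ≠ src m := by simp [edges]
    exact absurd h2 (this _ e'.2 m)
  · have : src m' = src m := Eq.trans h1 he
    rw [Node.src.inj this]; exact hm

/-- Every edge vector with tail `v` is determined by the messages satisfying `S` when the
in-edges of `v` come from sources of such messages. -/
theorem carries_of_src (h : c.Carries x y) (h' : c.Carries x' y') {S : Msg → Prop}
    (hS : ∀ m, S m → x m = x' m) {e : edges} (hv : ∀ m, src m ≠ e.1.1)
    (he : ∀ p ∈ edges, p.2 = e.1.1 → ∃ m, S m ∧ p.1 = src m) : y e = y' e := by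
  refine h.congr h' e (fun e' h1 => ?_) (fun m' h1 => absurd h1 (hv m'))
  obtain ⟨m, hm, h2⟩ := he _ e'.2 h1
  exact carries_src h h' (hS m hm) h2

/-- The edge carrying `W`, `X`, `Y` or `Z` that enters the tail of a relay edge determines the
vector on the relay edge. -/
theorem carries_relay (h : c.Carries x y) (h' : c.Carries x' y') {u v : Node}
    (huv : (u, v) ∈ edges) (hv : ∀ m, src m ≠ v) (hin : ∀ p ∈ edges, p.2 = v → p.1 = u)
    (hy : y ⟨(u, v), huv⟩ = y' ⟨(u, v), huv⟩) {e : edges} (he : e.1.1 = v) : y e = y' e := by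
  refine h.congr h' e (fun e' h1 => ?_) (fun m' h1 => absurd (Eq.trans h1 he) (hv m'))
  have h2 : e'.1.2 = v := Eq.trans h1 he
  have : e' = ⟨(u, v), huv⟩ := Subtype.ext (Prod.ext (hin _ e'.2 h2) h2)
  rw [this]; exact hy

/-- The edge carrying `W`. -/
def edgeW : edges := ⟨(n1, n2), by decide⟩
/-- The edge carrying `X`. -/
def edgeX : edges := ⟨(n3, n4), by decide⟩
/-- The edge carrying `Y`. -/
def edgeY : edges := ⟨(n5, n6), by decide⟩
/-- The edge carrying `Z`. -/
def edgeZ : edges := ⟨(n7, n8), by decide⟩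

/-- The in-edges of `n1` come from the sources of `B`, `C`, `D` only; the analogues for `X`, `Y`,
`Z` hold likewise. -/
theorem W_congr (h : c.Carries x y) (h' : c.Carries x' y') (hB : x B = x' B) (hC : x C = x' C)
    (hD : x D = x' D) : y edgeW = y' edgeW :=
  carries_of_src h h' (S := (· ≠ A)) (by rintro (_ | _) <;> simp_all) (by simp [edgeW])
    (by simp [edgeW, edges])

theorem X_congr (h : c.Carries x y) (h' : c.Carries x' y') (hA : x A = x' A) (hC : x C = x' C)
    (hD : x D = x' D) : y edgeX = y' edgeX :=
  carries_of_src h h' (S := (· ≠ B)) (by rintro (_ | _) <;> simp_all) (by simp [edgeX])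
    (by simp [edgeX, edges])

theorem Y_congr (h : c.Carries x y) (h' : c.Carries x' y') (hA : x A = x' A) (hB : x B = x' B)
    (hD : x D = x' D) : y edgeY = y' edgeY :=
  carries_of_src h h' (S := (· ≠ C)) (by rintro (_ | _) <;> simp_all) (by simp [edgeY])
    (by simp [edgeY, edges])

theorem Z_congr (h : c.Carries x y) (h' : c.Carries x' y') (hA : x A = x' A) (hB : x B = x' B)
    (hC : x C = x' C) : y edgeZ = y' edgeZ :=
  carries_of_src h h' (S := (· ≠ D)) (by rintro (_ | _) <;> simp_all) (by simp [edgeZ])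
    (by simp [edgeZ, edges])

theorem relayW (h : c.Carries x y) (h' : c.Carries x' y') (hW : y edgeW = y' edgeW)
    {e : edges} (he : e.1.1 = n2) : y e = y' e :=
  carries_relay h h' edgeW.2 (by simp) (by simp [edges]) hW he

theorem relayX (h : c.Carries x y) (h' : c.Carries x' y') (hX : y edgeX = y' edgeX)
    {e : edges} (he : e.1.1 = n4) : y e = y' e :=
  carries_relay h h' edgeX.2 (by simp) (by simp [edges]) hX he

theorem relayY (h : c.Carries x y) (h' : c.Carries x' y') (hY : y edgeY = y' edgeY)
    {e : edges} (he : e.1.1 = n6) : y e = y' e :=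
  carries_relay h h' edgeY.2 (by simp) (by simp [edges]) hY he

theorem relayZ (h : c.Carries x y) (h' : c.Carries x' y') (hZ : y edgeZ = y' edgeZ)
    {e : edges} (he : e.1.1 = n8) : y e = y' e :=
  carries_relay h h' edgeZ.2 (by simp) (by simp [edges]) hZ he

/-- The vectors `y` are those carried by the edges for the messages `x`, and every demanded
message is recovered from them. -/
def Solves (c : network.Code 𝒜 k n) (x : Msg → Fin k → 𝒜) (y : edges → Fin n → 𝒜) : Prop :=
  c.Carries x y ∧ ∀ (v : Node) (m : Msg) (hm : m ∈ demands v),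
    c.decodeFn v m hm (network.inputs x y v) = x m

/-- Decoding as injectivity: a demanded message cannot differ between two transmissions giving its
node the same inputs. `T` lists the tails of the in-edges of `v`. -/
theorem Solves.decode (h : Solves c x y) (h' : Solves c x' y') {v : Node} {m : Msg}
    (hm : m ∈ demands v) (hv : ∀ m, src m ≠ v) {T : List Node}
    (hT : ∀ p ∈ edges, p.2 = v → p.1 ∈ T)
    (hy : ∀ u ∈ T, ∀ e : edges, e.1.1 = u → y e = y' e) : x m = x' m := by
  rw [← h.2 v m hm, ← h'.2 v m hm]
  congr 1
  exact network.inputs_congr (fun e he => hy _ (hT _ e.2 he) e rfl)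
    (fun m hm => absurd hm (hv m))

theorem Solves.decode_n9 (h : Solves c x y) (h' : Solves c x' y') (hB : x B = x' B)
    (hW : y edgeW = y' edgeW) (hX : y edgeX = y' edgeX) : x A = x' A :=
  h.decode h' (v := n9) (T := [src B, n2, n4]) rfl (by simp) (by simp [edges]) (by
    simp only [List.forall_mem_cons, List.not_mem_nil, false_imp_iff, implies_true, and_true]
    exact ⟨fun _ => carries_src h.1 h'.1 hB, fun _ => relayW h.1 h'.1 hW,
      fun _ => relayX h.1 h'.1 hX⟩)

theorem Solves.decode_n10 (h : Solves c x y) (h' : Solves c x' y') (hA : x A = x' A)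
    (hW : y edgeW = y' edgeW) (hY : y edgeY = y' edgeY) : x C = x' C :=
  h.decode h' (v := n10) (T := [src A, n2, n6]) rfl (by simp) (by simp [edges]) (by
    simp only [List.forall_mem_cons, List.not_mem_nil, false_imp_iff, implies_true, and_true]
    exact ⟨fun _ => carries_src h.1 h'.1 hA, fun _ => relayW h.1 h'.1 hW,
      fun _ => relayY h.1 h'.1 hY⟩)

theorem Solves.decode_n11 (h : Solves c x y) (h' : Solves c x' y') (hC : x C = x' C)
    (hX : y edgeX = y' edgeX) (hY : y edgeY = y' edgeY) : x B = x' B :=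
  h.decode h' (v := n11) (T := [src C, n4, n6]) rfl (by simp) (by simp [edges]) (by
    simp only [List.forall_mem_cons, List.not_mem_nil, false_imp_iff, implies_true, and_true]
    exact ⟨fun _ => carries_src h.1 h'.1 hC, fun _ => relayX h.1 h'.1 hX,
      fun _ => relayY h.1 h'.1 hY⟩)

theorem Solves.decode_n12 (h : Solves c x y) (h' : Solves c x' y') (hA : x A = x' A)
    (hW : y edgeW = y' edgeW) (hZ : y edgeZ = y' edgeZ) : x D = x' D :=
  h.decode h' (v := n12) (T := [src A, n2, n8]) rfl (by simp) (by simp [edges]) (by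
    simp only [List.forall_mem_cons, List.not_mem_nil, false_imp_iff, implies_true, and_true]
    exact ⟨fun _ => carries_src h.1 h'.1 hA, fun _ => relayW h.1 h'.1 hW,
      fun _ => relayZ h.1 h'.1 hZ⟩)

theorem Solves.decode_n13 (h : Solves c x y) (h' : Solves c x' y') (hD : x D = x' D)
    (hX : y edgeX = y' edgeX) (hZ : y edgeZ = y' edgeZ) : x B = x' B :=
  h.decode h' (v := n13) (T := [src D, n4, n8]) rfl (by simp) (by simp [edges]) (by
    simp only [List.forall_mem_cons, List.not_mem_nil, false_imp_iff, implies_true, and_true]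
    exact ⟨fun _ => carries_src h.1 h'.1 hD, fun _ => relayX h.1 h'.1 hX,
      fun _ => relayZ h.1 h'.1 hZ⟩)

theorem Solves.decode_n14 (h : Solves c x y) (h' : Solves c x' y') (hD : x D = x' D)
    (hY : y edgeY = y' edgeY) (hZ : y edgeZ = y' edgeZ) : x C = x' C :=
  h.decode h' (v := n14) (T := [src D, n6, n8]) rfl (by simp) (by simp [edges]) (by
    simp only [List.forall_mem_cons, List.not_mem_nil, false_imp_iff, implies_true, and_true]
    exact ⟨fun _ => carries_src h.1 h'.1 hD, fun _ => relayY h.1 h'.1 hY,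
      fun _ => relayZ h.1 h'.1 hZ⟩)

theorem Solves.decode_n15 (h : Solves c x y) (h' : Solves c x' y') (hW : y edgeW = y' edgeW)
    (hX : y edgeX = y' edgeX) (hY : y edgeY = y' edgeY) (hZ : y edgeZ = y' edgeZ) :
    x A = x' A :=
  h.decode h' (v := n15) (T := [n2, n4, n6, n8]) rfl (by simp) (by simp [edges]) (by
    simp only [List.forall_mem_cons, List.not_mem_nil, false_imp_iff, implies_true, and_true]
    exact ⟨fun _ => relayW h.1 h'.1 hW, fun _ => relayX h.1 h'.1 hX,
      fun _ => relayY h.1 h'.1 hY, fun _ => relayZ h.1 h'.1 hZ⟩)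

/-- With the other messages fixed, `Y` determines `B`, so a message is no longer than an edge
vector. -/
theorem le_of_isSolution [Finite 𝒜] [Nontrivial 𝒜] (hc : c.IsSolution) : k ≤ n := by
  classical
  choose y hy using hc
  have hs : ∀ x, Solves c x (y x) := hy
  obtain ⟨a⟩ : Nonempty 𝒜 := inferInstance
  let x : (Fin k → 𝒜) → Msg → Fin k → 𝒜 := fun b => Function.update (fun _ _ => a) B b
  have hinj : Function.Injective fun b => y (x b) edgeY := by
    intro b b' hb
    -- Only `B` varies, and `X` does not see `B`.
    have hX := X_congr (hs (x b)).1 (hs (x b')).1 (by simp [x]) (by simp [x]) (by simp [x])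
    simpa [x] using (hs (x b)).decode_n11 (hs (x b')) (by simp [x]) hX hb
  have hcard := Nat.card_le_card_of_injective _ hinj
  simp only [Nat.card_fun, Nat.card_fin] at hcard
  exact (Nat.pow_le_pow_iff_right Finite.one_lt_card).1 hcard

/-- The edge vectors of a code are determined by the messages. -/
theorem carries_unique (h : c.Carries x y) (h' : c.Carries x y') : y = y' := by
  -- Induction on the layer of the tail, since in-edges of a tail start in a lower layer.
  have key : ∀ t, ∀ e : edges, layer e.1.1 < t → y e = y' e := by
    intro t
    induction t with
    | zero => intro e he; omega
    | succ t ih =>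
      intro e he
      refine h.congr h' e (fun e' h1 => ih e' ?_) (fun _ _ => rfl)
      have h2 : e'.1.2 = e.1.1 := h1
      have := layer_lt _ e'.2
      rw [h2] at this; omega
  exact funext fun e => key _ e (Nat.lt_succ_self _)

end Converse

end NonT8

/-! ### The rank inequality in characteristic three. -/

namespace NonT8

open Msg Node Network

/-- In characteristic three, a rank inequality for four linear maps satisfying the decoding
conditions of the non-T8 network: more than `10 * finrank U` unknowns would give a nonzero
quadruple `(a, b, c, d)` on which all four maps vanish. -/
theorem finrank_le_of_decodable {F V U : Type*} [Field F] [CharP F 3] [AddCommGroup V]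
    [Module F V] [FiniteDimensional F V] [AddCommGroup U] [Module F U] [FiniteDimensional F U]
    (W X Y Z : V × V × V →ₗ[F] U)
    (h9 : ∀ a c d, W (0, c, d) = 0 → X (a, c, d) = 0 → a = 0)
    (h10 : ∀ b c d, W (b, c, d) = 0 → Y (0, b, d) = 0 → c = 0)
    (h11 : ∀ a b d, X (a, 0, d) = 0 → Y (a, b, d) = 0 → b = 0)
    (h12 : ∀ b c d, W (b, c, d) = 0 → Z (0, b, c) = 0 → d = 0)
    (h13 : ∀ a b c, X (a, c, 0) = 0 → Z (a, b, c) = 0 → b = 0)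
    (h14 : ∀ a b c, Y (a, b, 0) = 0 → Z (a, b, c) = 0 → c = 0)
    (h15 : ∀ a b c d, W (b, c, d) = 0 → X (a, c, d) = 0 → Y (a, b, d) = 0 →
      Z (a, b, c) = 0 → a = 0) :
    11 * Module.finrank F V ≤ 10 * Module.finrank F U := by
  by_contra! hlt
  let p : Fin 11 → (Fin 11 → V) →ₗ[F] V := LinearMap.proj
  -- Coordinates 5, 3, 1, 0 play `a, b, c, d`. Coordinates 2, 4, 6, 8, 10 are slots that decoders
  -- force to zero, while 7 and 9 will be second copies of `c` and `a`. The ten conditions form five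
  -- pairs, one for each of `n9` to `n13`.
  let L : (Fin 11 → V) →ₗ[F] (Fin 10 → U) := LinearMap.pi
    ![W ∘ₗ (LinearMap.prod 0 ((p 1).prod (-p 0))), X ∘ₗ ((p 2).prod ((p 1).prod (-p 0))),
      W ∘ₗ ((p 3).prod ((p 4).prod (-p 0))), Y ∘ₗ (LinearMap.prod 0 ((p 3).prod (-p 0))),
      X ∘ₗ ((p 5).prod (LinearMap.prod 0 (-p 0))), Y ∘ₗ ((p 5).prod ((p 6).prod (-p 0))),
      W ∘ₗ ((p 3).prod ((-p 7).prod (p 8))), Z ∘ₗ (LinearMap.prod 0 ((p 3).prod (-p 7))),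
      X ∘ₗ ((p 9).prod ((-p 1).prod 0)), Z ∘ₗ ((p 9).prod ((p 10).prod (-p 1)))]
  have hker : LinearMap.ker L ≠ ⊥ := LinearMap.ker_ne_bot_of_finrank_lt (by
    simpa [Module.finrank_pi_fintype] using hlt)
  obtain ⟨v, hv, hv0⟩ := (Submodule.ne_bot_iff _).1 hker
  have hv' : ∀ i, L v i = 0 := fun i => congrFun (LinearMap.mem_ker.1 hv) i
  have e0 : W (0, v 1, -v 0) = 0 := hv' 0
  have e1 : X (v 2, v 1, -v 0) = 0 := hv' 1
  have e2 : W (v 3, v 4, -v 0) = 0 := hv' 2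
  have e3 : Y (0, v 3, -v 0) = 0 := hv' 3
  have e4 : X (v 5, 0, -v 0) = 0 := hv' 4
  have e5 : Y (v 5, v 6, -v 0) = 0 := hv' 5
  have e6 : W (v 3, -v 7, v 8) = 0 := hv' 6
  have e7 : Z (0, v 3, -v 7) = 0 := hv' 7
  have e8 : X (v 9, -v 1, 0) = 0 := hv' 8
  have e9 : Z (v 9, v 10, -v 1) = 0 := hv' 9
  have v2 := h9 _ _ _ e0 e1
  have v4 := h10 _ _ _ e2 e3
  have v6 := h11 _ _ _ e4 e5
  have v8 := h12 _ _ _ e6 e7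
  have v10 := h13 _ _ _ e8 e9
  rw [v2] at e1; rw [v4] at e2; rw [v6] at e5; rw [v8] at e6; rw [v10] at e9
  -- `W` kills `(b, 0, -d)`, `(b, -v 7, 0)` and `(0, c, -d)`, hence `(0, v 7 - c, 0)`; `n10` with `Y
  -- = 0` then applies.
  have v7 : v 7 = v 1 := by
    have := h10 0 (v 7 - v 1) 0 (by
      have : W (0, v 7 - v 1, 0) = W (v 3, 0, -v 0) - W (v 3, -v 7, 0) - W (0, v 1, -v 0) := by
        simp [← map_sub]
      rw [this, e0, e2, e6]; simp) (by exact map_zero Y)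
    exact sub_eq_zero.1 this
  -- The same device for `X`, with `n9` and `W = 0`.
  have v9 : v 9 = v 5 := by
    have := h9 (v 9 - v 5) 0 0 (by exact map_zero W) (by
      have : X (v 9 - v 5, 0, 0) = X (v 9, -v 1, 0) - X (v 5, 0, -v 0) + X (0, v 1, -v 0) := by
        simp [← map_sub, ← map_add]
      rw [this, e8, e4, e1]; simp)
    exact sub_eq_zero.1 this
  rw [v7] at e6 e7; rw [v9] at e8 e9
  have three : ∀ u : V, -u + -u = u := by
    intro u
    have : (3 : F) • u = 0 := by
      have h3 : (3 : F) = 0 := by exact_mod_cast CharP.cast_eq_zero F 3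
      rw [h3, zero_smul]
    have h : u + u + u = 0 := by rw [← this]; module
    rw [← sub_eq_zero, ← neg_eq_zero, ← h]; abel
  -- Each map kills two vectors whose sum is its part of `(a, b, c, d)`, because the coordinate
  -- occurring twice has coefficient `-2 = 1`.
  have v5 : v 5 = 0 := by
    refine h15 (v 5) (v 3) (v 1) (v 0) ?_ ?_ ?_ ?_
    · have := congrArg₂ (· + ·) e0 e2
      simpa [← map_add, three] using this
    · have := congrArg₂ (· + ·) e1 e4
      simpa [← map_add, three] using this
    · have := congrArg₂ (· + ·) e3 e5
      simpa [← map_add, three] using this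
    · have := congrArg₂ (· + ·) e7 e9
      simpa [← map_add, three] using this
  -- With `a = 0`, the conditions collapse one at a time to a single unknown: `c`, then `d`, then
  -- `b`.
  rw [v5] at e9
  have v1 : v 1 = 0 := neg_eq_zero.1 (h14 0 0 _ (by exact map_zero Y) e9)
  rw [v1] at e0
  have v0 : v 0 = 0 := neg_eq_zero.1 (h12 0 0 _ e0 (by exact map_zero Z))
  rw [v0, neg_zero] at e3
  have v3 : v 3 = 0 := h11 0 _ 0 (by exact map_zero X) e3
  refine hv0 (funext fun i => ?_)
  fin_cases i
  exacts [v0, v1, v2, v3, v4, v5, v6, v7.trans v1, v8, v9.trans v5, v10]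

/-! ### From linear codes to the rank inequality. -/

section Linear

variable {F : Type*} [Field F] {k n : ℕ} {c : network.Code F k n}

/-- The edge vectors of a linear solution depend linearly on the messages. -/
theorem exists_linear_edge_vectors (hl : c.IsLinear) (hc : c.IsSolution) :
    ∃ L : (Msg → Fin k → F) →ₗ[F] (edges → Fin n → F), ∀ x, Solves c x (L x) := by
  choose y hy using hc
  have hs : ∀ x, Solves c x (y x) := hy
  refine ⟨⟨⟨y, fun x x' => ?_⟩, fun r x => ?_⟩, hs⟩
  · refine carries_unique (hs (x + x')).1 fun e => ?_
    refine (congrArg₂ (· + ·) ((hs x).1 e) ((hs x').1 e)).trans ?_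
    exact ((hl.1 e).map_add _ _).symm
  · refine carries_unique (hs (r • x)).1 fun e => ?_
    refine (congrArg (r • ·) ((hs x).1 e)).trans ?_
    exact ((hl.1 e).map_smul r _).symm

/-- The messages with given values. -/
def messages {V : Type*} (a b c d : V) : Msg → V
  | A => a
  | B => b
  | C => c
  | D => d

/-- `messages` as a linear map. -/
def messagesLin (F V : Type*) [Field F] [AddCommGroup V] [Module F V] :
    V × V × V × V →ₗ[F] Msg → V where
  toFun q := messages q.1 q.2.1 q.2.2.1 q.2.2.2
  map_add' q q' := by funext m; cases m <;> rfl
  map_smul' r q := by funext m; cases m <;> rfl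

/-- Each bottleneck vector is a linear map of the three messages it sees, obtained by setting the
fourth to zero. Comparing with the zero transmission turns decodability into the vanishing
hypotheses of `finrank_le_of_decodable`. -/
theorem rate_le_of_isLinear [CharP F 3] (hl : c.IsLinear) (hc : c.IsSolution) :
    11 * k ≤ 10 * n := by
  obtain ⟨L, hL⟩ := exists_linear_edge_vectors hl hc
  let M (a b c d : Fin k → F) : Msg → Fin k → F := messages a b c d
  let E (e : edges) : (Fin k → F) × (Fin k → F) × (Fin k → F) × (Fin k → F) →ₗ[F] Fin n → F :=
    LinearMap.proj e ∘ₗ L ∘ₗ messagesLin F (Fin k → F)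
  let I : (Fin k → F) × (Fin k → F) × (Fin k → F) →ₗ[F] Fin k → F := LinearMap.fst F _ _
  let J : (Fin k → F) × (Fin k → F) × (Fin k → F) →ₗ[F] Fin k → F :=
    LinearMap.fst F _ _ ∘ₗ LinearMap.snd F _ _
  let K : (Fin k → F) × (Fin k → F) × (Fin k → F) →ₗ[F] Fin k → F :=
    LinearMap.snd F _ _ ∘ₗ LinearMap.snd F _ _
  let W := E edgeW ∘ₗ (LinearMap.prod 0 (I.prod (J.prod K)))
  let X := E edgeX ∘ₗ (I.prod (LinearMap.prod 0 (J.prod K)))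
  let Y := E edgeY ∘ₗ (I.prod (J.prod (LinearMap.prod 0 K)))
  let Z := E edgeZ ∘ₗ (I.prod (J.prod (K.prod 0)))
  have hW : ∀ a b c d, W (b, c, d) = 0 → L (M a b c d) edgeW = L 0 edgeW := by
    intro a b c d h
    rw [map_zero]
    exact (W_congr (hL (M a b c d)).1 (hL (M 0 b c d)).1 rfl rfl rfl).trans h
  have hX : ∀ a b c d, X (a, c, d) = 0 → L (M a b c d) edgeX = L 0 edgeX := by
    intro a b c d h
    rw [map_zero]
    exact (X_congr (hL (M a b c d)).1 (hL (M a 0 c d)).1 rfl rfl rfl).trans h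
  have hY : ∀ a b c d, Y (a, b, d) = 0 → L (M a b c d) edgeY = L 0 edgeY := by
    intro a b c d h
    rw [map_zero]
    exact (Y_congr (hL (M a b c d)).1 (hL (M a b 0 d)).1 rfl rfl rfl).trans h
  have hZ : ∀ a b c d, Z (a, b, c) = 0 → L (M a b c d) edgeZ = L 0 edgeZ := by
    intro a b c d h
    rw [map_zero]
    exact (Z_congr (hL (M a b c d)).1 (hL (M a b c 0)).1 rfl rfl rfl).trans h
  have := finrank_le_of_decodable W X Y Z
    (fun a c d h1 h2 => (hL (M a 0 c d)).decode_n9 (hL 0) rfl (hW _ _ _ _ h1) (hX _ _ _ _ h2))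
    (fun b c d h1 h2 => (hL (M 0 b c d)).decode_n10 (hL 0) rfl (hW _ _ _ _ h1) (hY _ _ _ _ h2))
    (fun a b d h1 h2 => (hL (M a b 0 d)).decode_n11 (hL 0) rfl (hX _ _ _ _ h1) (hY _ _ _ _ h2))
    (fun b c d h1 h2 => (hL (M 0 b c d)).decode_n12 (hL 0) rfl (hW _ _ _ _ h1) (hZ _ _ _ _ h2))
    (fun a b c h1 h2 => (hL (M a b c 0)).decode_n13 (hL 0) rfl (hX _ _ _ _ h1) (hZ _ _ _ _ h2))
    (fun a b c h1 h2 => (hL (M a b c 0)).decode_n14 (hL 0) rfl (hY _ _ _ _ h1) (hZ _ _ _ _ h2))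
    (fun a b c d h1 h2 h3 h4 => (hL (M a b c d)).decode_n15 (hL 0) (hW _ _ _ _ h1)
      (hX _ _ _ _ h2) (hY _ _ _ _ h3) (hZ _ _ _ _ h4))
  simpa using this

end Linear

end NonT8

/-! ### Codes from abelian groups without 3-torsion. -/

namespace NonT8

open Msg Node Network

/-- The group element sent on all out-edges of a node by the code with
`W = B + C + D`, `X = A + C + D`, `Y = A + B + D`, `Z = A + B + C`. -/
def nodeValue {G : Type*} [AddCommGroup G] (x : Msg → G) : Node → G
  | src m => x m
  | n1 | n2 => x B + x C + x D
  | n3 | n4 => x A + x C + x D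
  | n5 | n6 => x A + x B + x D
  | n7 | n8 => x A + x B + x C
  | _ => 0

section Determined

variable {G : Type*} [AddCommGroup G] {x x' : Msg → G} {v : Node}

theorem nodeValue_congr
    (hy : ∀ p ∈ edges, p.2 = v → nodeValue x p.1 = nodeValue x' p.1)
    (hx : ∀ m, src m = v → x m = x' m) : nodeValue x v = nodeValue x' v := by
  have add₃ : ∀ {a b c a' b' c' : G}, a = a' → b = b' → c = c' → a + b + c = a' + b' + c' := by
    rintro _ _ _ _ _ _ rfl rfl rfl; rfl
  cases v with
  | src m => exact hx m rfl
  | n1 =>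
    exact add₃ (hy (src B, n1) (by decide) rfl) (hy (src C, n1) (by decide) rfl)
      (hy (src D, n1) (by decide) rfl)
  | n3 =>
    exact add₃ (hy (src A, n3) (by decide) rfl) (hy (src C, n3) (by decide) rfl)
      (hy (src D, n3) (by decide) rfl)
  | n5 =>
    exact add₃ (hy (src A, n5) (by decide) rfl) (hy (src B, n5) (by decide) rfl)
      (hy (src D, n5) (by decide) rfl)
  | n7 =>
    exact add₃ (hy (src A, n7) (by decide) rfl) (hy (src B, n7) (by decide) rfl)
      (hy (src C, n7) (by decide) rfl)
  | n2 => exact hy (n1, n2) (by decide) rfl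
  | n4 => exact hy (n3, n4) (by decide) rfl
  | n6 => exact hy (n5, n6) (by decide) rfl
  | n8 => exact hy (n7, n8) (by decide) rfl
  | _ => rfl

theorem demanded_congr (h3 : ∀ g : G, 3 • g = 0 → g = 0)
    (hy : ∀ p ∈ edges, p.2 = v → nodeValue x p.1 = nodeValue x' p.1) {m : Msg}
    (hm : m ∈ demands v) : x m = x' m := by
  -- By additivity it suffices to treat the difference of the two message families.
  have sol : ∀ {z : Msg → G}, (∀ p ∈ edges, p.2 = v → nodeValue z p.1 = 0) → z m = 0 := by
    intro z hz
    cases v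
    case n9 =>
      obtain rfl : m = A := hm
      have e0 : z B = 0 := hz (src B, n9) (by decide) rfl
      have e1 : z A + z C + z D = 0 := hz (n4, n9) (by decide) rfl
      have e2 : z B + z C + z D = 0 := hz (n2, n9) (by decide) rfl
      calc z A = (z A + z C + z D) - (z B + z C + z D) + z B := by abel
        _ = 0 := by rw [e1, e2, e0]; simp
    case n10 =>
      obtain rfl : m = C := hm
      have e0 : z A = 0 := hz (src A, n10) (by decide) rfl
      have e1 : z B + z C + z D = 0 := hz (n2, n10) (by decide) rfl
      have e2 : z A + z B + z D = 0 := hz (n6, n10) (by decide) rfl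
      calc z C = (z B + z C + z D) - (z A + z B + z D) + z A := by abel
        _ = 0 := by rw [e1, e2, e0]; simp
    case n11 =>
      obtain rfl : m = B := hm
      have e0 : z C = 0 := hz (src C, n11) (by decide) rfl
      have e1 : z A + z B + z D = 0 := hz (n6, n11) (by decide) rfl
      have e2 : z A + z C + z D = 0 := hz (n4, n11) (by decide) rfl
      calc z B = (z A + z B + z D) - (z A + z C + z D) + z C := by abel
        _ = 0 := by rw [e1, e2, e0]; simp
    case n12 =>
      obtain rfl : m = D := hm
      have e0 : z A = 0 := hz (src A, n12) (by decide) rfl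
      have e1 : z B + z C + z D = 0 := hz (n2, n12) (by decide) rfl
      have e2 : z A + z B + z C = 0 := hz (n8, n12) (by decide) rfl
      calc z D = (z B + z C + z D) - (z A + z B + z C) + z A := by abel
        _ = 0 := by rw [e1, e2, e0]; simp
    case n13 =>
      obtain rfl : m = B := hm
      have e0 : z D = 0 := hz (src D, n13) (by decide) rfl
      have e1 : z A + z B + z C = 0 := hz (n8, n13) (by decide) rfl
      have e2 : z A + z C + z D = 0 := hz (n4, n13) (by decide) rfl
      calc z B = (z A + z B + z C) - (z A + z C + z D) + z D := by abel
        _ = 0 := by rw [e1, e2, e0]; simp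
    case n14 =>
      obtain rfl : m = C := hm
      have e0 : z D = 0 := hz (src D, n14) (by decide) rfl
      have e1 : z A + z B + z C = 0 := hz (n8, n14) (by decide) rfl
      have e2 : z A + z B + z D = 0 := hz (n6, n14) (by decide) rfl
      calc z C = (z A + z B + z C) - (z A + z B + z D) + z D := by abel
        _ = 0 := by rw [e1, e2, e0]; simp
    case n15 =>
      obtain rfl : m = A := hm
      have e0 : z B + z C + z D = 0 := hz (n2, n15) (by decide) rfl
      have e1 : z A + z C + z D = 0 := hz (n4, n15) (by decide) rfl
      have e2 : z A + z B + z D = 0 := hz (n6, n15) (by decide) rfl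
      have e3 : z A + z B + z C = 0 := hz (n8, n15) (by decide) rfl
      -- The only demand that needs the absence of 3-torsion.
      refine h3 _ ?_
      calc 3 • z A = (z A + z C + z D) + (z A + z B + z D) + (z A + z B + z C)
            - 2 • (z B + z C + z D) := by abel
        _ = 0 := by rw [e0, e1, e2, e3]; simp
    all_goals exact absurd hm (Set.notMem_empty m)
  have sub : ∀ u, nodeValue (x - x') u = nodeValue x u - nodeValue x' u := by
    intro u
    cases u <;> simp [nodeValue] <;> abel
  refine sub_eq_zero.1 (sol (z := x - x') fun p hp hv => ?_)
  rw [sub, hy p hp hv, sub_self]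

end Determined

/-- A group without 3-torsion lying between messages and edge vectors gives a solution. -/
theorem exists_isSolution_of_embeddings {𝒜 G : Type*} [Nonempty 𝒜] [AddCommGroup G]
    (h3 : ∀ g : G, 3 • g = 0 → g = 0) {k n : ℕ} (φ : (Fin k → 𝒜) ↪ G) (ψ : G ↪ (Fin n → 𝒜)) :
    ∃ c : network.Code 𝒜 k n, c.IsSolution := by
  obtain ⟨a⟩ := ‹Nonempty 𝒜›
  let y : (Msg → Fin k → 𝒜) → edges → Fin n → 𝒜 :=
    fun x e => ψ (nodeValue (fun m => φ (x m)) e.1.1)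
  let I : (v : Node) → (Msg → Fin k → 𝒜) → network.Inputs 𝒜 k n v :=
    fun v x => network.inputs x (y x) v
  have hI : ∀ v x x', I v x = I v x' →
      (∀ p ∈ edges, p.2 = v →
        nodeValue (fun m => φ (x m)) p.1 = nodeValue (fun m => φ (x' m)) p.1) ∧
      ∀ m, src m = v → φ (x m) = φ (x' m) := by
    intro v x x' h
    refine ⟨fun p hp hv => ?_, fun m hm => ?_⟩
    · exact ψ.injective (congrFun (congrArg Prod.fst h) ⟨⟨p, hp⟩, hv⟩)
    · exact congrArg φ (congrFun (congrArg Prod.snd h) ⟨m, hm⟩)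
  -- The local functions are read off the global assignment; `a` fills in for inputs that never
  -- occur.
  refine ⟨⟨fun e => Function.extend (I e.1.1) (fun x => y x e) (fun _ _ => a),
    fun v m _ => Function.extend (I v) (fun x => x m) (fun _ _ => a)⟩, fun x => ⟨y x, ?_, ?_⟩⟩
  · intro e
    have : Function.FactorsThrough (fun x => y x e) (I e.1.1) := fun x x' h =>
      congrArg ψ (nodeValue_congr (hI _ _ _ h).1 (hI _ _ _ h).2)
    exact (this.extend_apply (fun _ _ => a) x).symm
  · intro v m hm
    have : Function.FactorsThrough (fun x : Msg → Fin k → 𝒜 => x m) (I v) := fun x x' h =>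
      φ.injective (demanded_congr h3 (hI _ _ _ h).1 hm)
    exact this.extend_apply (fun _ _ => a) x

/-- A linear map vanishing on the kernel of another one factors through it. -/
theorem exists_linear_factor {F V U T : Type*} [Field F] [AddCommGroup V] [Module F V]
    [AddCommGroup U] [Module F U] [AddCommGroup T] [Module F T] (f : V →ₗ[F] U) (g : V →ₗ[F] T)
    (h : ∀ x, f x = 0 → g x = 0) : ∃ t : U →ₗ[F] T, ∀ x, t (f x) = g x := by
  obtain ⟨s, hs⟩ := LinearMap.exists_rightInverse_of_surjective f.rangeRestrict f.range_rangeRestrict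
  obtain ⟨t, ht⟩ := LinearMap.exists_extend (g ∘ₗ s)
  refine ⟨t, fun x => ?_⟩
  have h1 : t (f x) = g (s (f.rangeRestrict x)) := LinearMap.congr_fun ht (f.rangeRestrict x)
  rw [h1, ← sub_eq_zero, ← map_sub]
  apply h
  have h2 : f.rangeRestrict (s (f.rangeRestrict x)) = f.rangeRestrict x :=
    LinearMap.congr_fun hs _
  rw [map_sub, sub_eq_zero]
  exact congrArg Subtype.val h2

/-- `nodeValue` is linear in the messages. -/
def nodeValueLin (F V : Type*) [Field F] [AddCommGroup V] [Module F V] (v : Node) :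
    (Msg → V) →ₗ[F] V where
  toFun x := nodeValue x v
  map_add' x x' := by cases v <;> simp [nodeValue] <;> abel
  map_smul' r x := by cases v <;> simp [nodeValue]

theorem exists_isLinear_isSolution {F : Type*} [Field F] (h3 : (3 : F) ≠ 0) (k : ℕ) :
    ∃ c : network.Code F k k, c.IsLinear ∧ c.IsSolution := by
  let y : (Msg → Fin k → F) →ₗ[F] edges → Fin k → F :=
    LinearMap.pi fun e => nodeValueLin F _ e.1.1
  let I (v : Node) : (Msg → Fin k → F) →ₗ[F] network.Inputs F k k v :=
    { toFun := fun x => network.inputs x (y x) v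
      map_add' := fun x x' => by rw [map_add]; rfl
      map_smul' := fun r x => by rw [map_smul]; rfl }
  have hI : ∀ v x, I v x = 0 →
      (∀ p ∈ edges, p.2 = v → nodeValue x p.1 = nodeValue (0 : Msg → Fin k → F) p.1) ∧
      ∀ m, src m = v → x m = (0 : Msg → Fin k → F) m := by
    intro v x h
    refine ⟨fun p hp hv => ?_, fun m hm => ?_⟩
    · exact (congrFun (congrArg Prod.fst h) ⟨⟨p, hp⟩, hv⟩).trans
        (map_zero (nodeValueLin F (Fin k → F) p.1)).symm
    · exact congrFun (congrArg Prod.snd h) ⟨m, hm⟩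
  have h3' : ∀ g : Fin k → F, 3 • g = 0 → g = 0 := by
    intro g hg
    funext i
    have := congrFun hg i
    simpa [h3] using this
  -- Linear factorization replaces the arbitrary extension, so that the functions stay linear off
  -- the occurring inputs.
  choose t ht using fun e : edges => exists_linear_factor (I e.1.1) (LinearMap.proj e ∘ₗ y)
    fun x h => (nodeValue_congr (hI _ _ h).1 (hI _ _ h).2).trans
      (map_zero (nodeValueLin F (Fin k → F) e.1.1))
  choose s hs using fun (v : Node) (m : Msg) (hm : m ∈ demands v) =>
    exists_linear_factor (I v) (LinearMap.proj m) fun x h => demanded_congr h3' (hI _ _ h).1 hm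
  exact ⟨⟨fun e => t e, fun v m hm => s v m hm⟩,
    ⟨fun e => (t e).isLinear, fun v m hm => (s v m hm).isLinear⟩,
    fun x => ⟨y x, fun e => (ht e x).symm, fun v m hm => hs v m hm x⟩⟩

/-- Over any alphabet there are solutions of rate `k / (k + 1)`. -/
theorem exists_isSolution {𝒜 : Type*} [Finite 𝒜] [Nontrivial 𝒜] (k : ℕ) :
    ∃ c : network.Code 𝒜 k (k + 1), c.IsSolution := by
  have hq : 2 ≤ Nat.card 𝒜 := Finite.one_lt_card
  set q := Nat.card 𝒜
  have hpos : 1 ≤ q ^ k := Nat.one_le_pow _ _ (by omega)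
  have hsucc : q ^ k + 1 ≤ q ^ (k + 1) := by rw [pow_succ]; nlinarith
  -- One of two consecutive integers is prime to 3; the extra edge symbol leaves room for both.
  obtain ⟨M, h1, h2, hM⟩ : ∃ M, q ^ k ≤ M ∧ M ≤ q ^ (k + 1) ∧ ¬ 3 ∣ M := by
    by_cases h : 3 ∣ q ^ k
    · exact ⟨q ^ k + 1, by omega, hsucc, by omega⟩
    · exact ⟨q ^ k, le_rfl, by omega, h⟩
  have : NeZero M := ⟨by omega⟩
  have hcop : Nat.Coprime 3 M := (Nat.Prime.coprime_iff_not_dvd Nat.prime_three).2 hM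
  have h3 : ∀ g : ZMod M, 3 • g = 0 → g = 0 := by
    intro g hg
    have hu : IsUnit ((3 : ℕ) : ZMod M) := (ZMod.isUnit_iff_coprime 3 M).2 hcop
    rw [nsmul_eq_mul] at hg
    exact (hu.mul_right_eq_zero).1 hg
  have := Fintype.ofFinite 𝒜
  have hcard : ∀ j, Fintype.card (Fin j → 𝒜) = q ^ j := by
    intro j; simp [q, Nat.card_eq_fintype_card]
  obtain ⟨φ⟩ : Nonempty ((Fin k → 𝒜) ↪ ZMod M) :=
    Function.Embedding.nonempty_of_card_le (by rw [hcard, ZMod.card]; exact h1)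
  obtain ⟨ψ⟩ : Nonempty (ZMod M ↪ (Fin (k + 1) → 𝒜)) :=
    Function.Embedding.nonempty_of_card_le (by rw [hcard, ZMod.card]; exact h2)
  exact exists_isSolution_of_embeddings h3 φ ψ

end NonT8


/-! ### Capacity bounds. -/

namespace NonT8

open Network

theorem linearCapacity_le_capacity (N : Network) (F : Type*) [Field F] :
    N.linearCapacity F ≤ N.capacity F :=
  sSup_le_sSup fun _ ⟨k, n, hk, hn, ⟨c, _, hc⟩, hr⟩ => ⟨k, n, hk, hn, ⟨c, hc⟩, hr⟩

theorem capacity_le_one (𝒜 : Type*) [Finite 𝒜] [Nontrivial 𝒜] : network.capacity 𝒜 ≤ 1 := by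
  refine sSup_le ?_
  rintro _ ⟨k, n, -, -, ⟨c, hc⟩, rfl⟩
  refine ENNReal.div_le_of_le_mul ?_
  rw [one_mul]
  exact_mod_cast le_of_isSolution hc

theorem one_le_capacity (𝒜 : Type*) [Finite 𝒜] [Nontrivial 𝒜] : 1 ≤ network.capacity 𝒜 := by
  have h : ∀ k : ℕ, 0 < k → (k : ℝ≥0∞) / ((k + 1 : ℕ) : ℝ≥0∞) ≤ network.capacity 𝒜 :=
    fun k hk => le_sSup ⟨k, k + 1, hk, k.succ_pos, exists_isSolution k, rfl⟩
  have htop : network.capacity 𝒜 ≠ ⊤ := ne_top_of_le_ne_top ENNReal.one_ne_top (capacity_le_one 𝒜)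
  lift network.capacity 𝒜 to NNReal using htop with t
  by_contra! hlt
  have ht : (t : ℝ) < 1 := by exact_mod_cast hlt
  -- For this `k`, `k (1 - t) > 1`, whereas `k / (k + 1) ≤ t` gives `k (1 - t) ≤ t < 1`.
  obtain ⟨k, hk⟩ := exists_nat_gt (1 / (1 - (t : ℝ)))
  have hk' : 1 < (k : ℝ) * (1 - t) := (div_lt_iff₀ (by linarith)).1 hk
  have hk0 : 0 < k := by
    rcases Nat.eq_zero_or_pos k with rfl | h
    · norm_num at hk'
    · exact h
  have h1 : (k : ℝ≥0∞) ≤ t * ((k + 1 : ℕ) : ℝ≥0∞) :=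
    (ENNReal.div_le_iff (by simp) (ENNReal.natCast_ne_top _)).1 (h k hk0)
  have h2 : (k : ℝ) ≤ t * ((k + 1 : ℕ) : ℝ) := by exact_mod_cast h1
  push_cast at h2
  nlinarith

theorem linearCapacity_le (F : Type*) [Field F] [CharP F 3] :
    network.linearCapacity F ≤ 10 / 11 := by
  refine sSup_le ?_
  rintro _ ⟨k, n, -, hn, ⟨c, hl, hc⟩, rfl⟩
  have h := rate_le_of_isLinear hl hc
  rw [ENNReal.div_le_iff (by exact_mod_cast hn.ne') (ENNReal.natCast_ne_top _),
    ← ENNReal.mul_div_right_comm, ENNReal.le_div_iff_mul_le (by simp) (by simp)]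
  rw [mul_comm]
  exact_mod_cast h

theorem one_le_linearCapacity {F : Type*} [Field F] (h3 : (3 : F) ≠ 0) :
    1 ≤ network.linearCapacity F :=
  le_sSup ⟨1, 1, one_pos, one_pos, exists_isLinear_isSolution h3 1, by simp⟩

end NonT8

theorem mainTheorem4 :
    (∀ (F : Type*) [Field F] [Finite F], ringChar F = 3 →
      NonT8.network.linearCapacity F ≤ 28 / 29) ∧
    (∀ (F : Type*) [Field F] [Finite F], ringChar F ≠ 3 →
      NonT8.network.linearCapacity F = 1) ∧
    (∀ (𝒜 : Type*) [Finite 𝒜] [Nontrivial 𝒜],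
      NonT8.network.capacity 𝒜 = 1) := by
  refine ⟨fun F _ _ hF => ?_, fun F _ _ hF => ?_, fun 𝒜 _ _ => ?_⟩
  · have : CharP F 3 := ringChar.of_eq hF
    -- The bound 10/11 is below 28/29, as `10 * 29 = 290 ≤ 308 = 28 * 11`.
    refine (NonT8.linearCapacity_le F).trans ?_
    rw [ENNReal.div_le_iff (by simp) (by simp), ← ENNReal.mul_div_right_comm,
      ENNReal.le_div_iff_mul_le (by simp) (by simp)]
    norm_num
  · have h3 : (3 : F) ≠ 0 := by
      intro h
      have h' : ((3 : ℕ) : F) = 0 := by exact_mod_cast h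
      have hd : ringChar F ∣ 3 := ringChar.dvd h'
      rcases (Nat.dvd_prime Nat.prime_three).1 hd with h1 | h1
      · exact CharP.ringChar_ne_one h1
      · exact hF h1
    exact le_antisymm ((NonT8.linearCapacity_le_capacity _ F).trans (NonT8.capacity_le_one F))
      (NonT8.one_le_linearCapacity h3)
  · exact le_antisymm (NonT8.capacity_le_one 𝒜) (NonT8.one_le_capacity 𝒜)
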